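/- Let $m\ge 2$ agents form a connected undirected network $G$ and let $W\in\mathbb R^{m\times m}$ be a weight matrix of it: $W$ is symmetric, $W_{ij}\neq 0$ if and only if $i,j$ are adjacent in $G$ or $i=j$, $0\preceq W\preceq I$, $W\mathbf 1=\mathbf 1$ and $\mathrm{null}(I-W)=\mathrm{span}(\mathbf 1)$. Let $\lambda_2(W)$ be its second largest eigenvalue. Let $F(x)=\frac1m\sum_{i=1}^m f_i(x)+g(x)$ on $\mathbb R^d$, where each $f_i:\mathbb R^d\to\mathbb R$ is differentiable, convex and $L$-smooth, i.e. $0\le f_i(y)-f_i(x)-\langle\nabla f_i(x),y-x\rangle\le\frac L2\|x-y\|^2$ for all $x,y$, with $L>0$, and $g:\mathbb R^d\to\mathbb R$ is convex. Assume that $F$ has a minimizer $x^*$. For an $m\times d$ matrix $\mathbf x$ with rows $\mathbf x^{(i)}$ let $\overline x$ be the average of its rows, $\nabla f(\mathbf x)$ the matrix with rows $\nabla f_i(\mathbf x^{(i)})$, and $\mathrm{prox}_{\gamma g}(\mathbf x)$ the matrix whose $i$-th row is $\operatorname{argmin}_w\big(\gamma g(w)+\frac12\|w-\mathbf x^{(i)}\|^2\big)$.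 $\mathrm{FastMix}(\mathbf x,K)$ sets $\mathbf x^0=\mathbf x^1=\mathbf x$, performs the $K$ communication rounds $\mathbf x^{k+1}=(1+\eta_w)W\mathbf x^k-\eta_w\mathbf x^{k-1}$, $k=1,\dots,K$, with $\eta_w=1/(1+\sqrt{1-\lambda_2(W)^2})$, and returns $\mathbf x^K$. ODAPG starts from $x_1\in\mathbb R^d$ with $\mathbf x_1=\mathbf y_1=\mathbf z_1=\mathbf 1x_1$, $\mathbf s_1=\nabla f(\mathbf x_1)$, and iterates for $t=1,2,\dots$ $$\mathbf x_{t+1}=\tau_t\mathbf z_t+(1-\tau_t)\mathbf y_t,\qquad \mathbf s_{t+1}=\mathrm{FastMix}(\mathbf s_t+\nabla f(\mathbf x_{t+1})-\nabla f(\mathbf x_t),K),$$ $$\mathbf z_{t+1}=\mathrm{FastMix}(\mathrm{prox}_{\gamma_t g}(\mathbf z_t-\gamma_t\mathbf s_{t+1}),K),\qquad \mathbf y_{t+1}=\mathrm{FastMix}(\tau_t\mathbf z_{t+1}+(1-\tau_t)\mathbf y_t,K),$$ with $\gamma_t=\frac{t+4}{400L}$, $\tau_t=\frac2{t+4}$ and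 $K=\lceil 15/\sqrt{1-\lambda_2(W)}\,\rceil$. Then, to find an $\epsilon$-suboptimal solution, i.e. $F(\overline y)-F(x^*)\le\epsilon$, each agent needs $\mathcal O(1/\sqrt\epsilon)$ gradient computations and $\mathcal O\big(1/\sqrt{\epsilon(1-\lambda_2(W))}\big)$ communication rounds. Precisely: for all reals $L>0$ and $\Delta,D,S$ there are constants $c_1,c_2>0$, depending only on $L,\Delta,D,S$, such that for every problem, network and starting point as above with $F(x_1)-F(x^*)\le\Delta$, $\|x_1-x^*\|\le D$ and $\sum_{i=1}^m\big\|\nabla f_i(x_1)-\frac1m\sum_{j=1}^m\nabla f_j(x_1)\big\|^2\le S$, and for every $0<\epsilon\le 1$, there is $T\in\mathbb N$ such that the first $T$ iterations of ODAPG use, for each agent, at most $c_1/\sqrt\epsilon$ gradient computations (the one at the initialization included) and at most $c_2/\sqrt{\epsilon(1-\lambda_2(W))}$ communication rounds, and after $T$ or more iterations the current average $\overline y$ satisfies $F(\overline y)-F(x^*)\le\epsilon$. -/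

import Mathlib

noncomputable section

namespace Decentralized

/-- The space of decision variables, with the Euclidean norm. -/
abbrev Vec (d : ℕ) : Type := EuclideanSpace ℝ (Fin d)

/-- An `m × d` matrix, as the family of its rows; row `i` is the local copy of agent `i`. -/
abbrev Stack (m d : ℕ) : Type := Fin m → Vec d

/-- The average of the rows. -/
def average {m d : ℕ} (x : Stack m d) : Vec d := (m : ℝ)⁻¹ • ∑ i, x i

/-- The squared Frobenius norm of `x - 1 x̄`, the squared consensus error. -/
def consensusErrorSq {m d : ℕ} (x : Stack m d) : ℝ := ∑ i, ‖x i - average x‖ ^ 2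

/-- `φ` is convex and `L`-smooth. -/
structure IsConvexSmooth {d : ℕ} (L : ℝ) (φ : Vec d → ℝ) : Prop where
  differentiable : Differentiable ℝ φ
  lower : ∀ x y, φ x + inner ℝ (gradient φ x) (y - x) ≤ φ y
  upper : ∀ x y, φ y ≤ φ x + inner ℝ (gradient φ x) (y - x) + L / 2 * ‖x - y‖ ^ 2

/-- The composite objective `F = (1/m) ∑ fᵢ + g`. -/
def objective {m d : ℕ} (f : Fin m → Vec d → ℝ) (g : Vec d → ℝ) (x : Vec d) : ℝ :=
  (m : ℝ)⁻¹ * ∑ i, f i x + g x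

/-- The aggregate gradient: row `i` is the gradient of `fᵢ` at row `i` of `x`. -/
def aggGradient {m d : ℕ} (f : Fin m → Vec d → ℝ) (x : Stack m d) : Stack m d :=
  fun i => gradient (f i) (x i)

/-- `w` minimizes `γ g(w) + ‖w - x‖² / 2`. -/
def IsProx {d : ℕ} (γ : ℝ) (g : Vec d → ℝ) (x w : Vec d) : Prop :=
  ∀ w', γ * g w + 1 / 2 * ‖w - x‖ ^ 2 ≤ γ * g w' + 1 / 2 * ‖w' - x‖ ^ 2

/-- The proximal operator: the minimizer of `γ g(w) + ‖w - x‖² / 2`. -/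
def prox {d : ℕ} (γ : ℝ) (g : Vec d → ℝ) (x : Vec d) : Vec d :=
  Classical.epsilon (IsProx γ g x)

/-- The aggregated proximal operator, acting on each row. -/
def aggProx {m d : ℕ} (γ : ℝ) (g : Vec d → ℝ) (x : Stack m d) : Stack m d :=
  fun i => prox γ g (x i)

/-- `W` is a mixing (weight) matrix of the connected network `G`. -/
structure IsMixingMatrix {m : ℕ} (G : SimpleGraph (Fin m)) (W : Matrix (Fin m) (Fin m) ℝ) :
    Prop where
  connected : G.Connected
  symm : W.IsSymm
  support : ∀ i j, W i j ≠ 0 ↔ G.Adj i j ∨ i = j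
  posSemidef : W.PosSemidef
  le_one : (1 - W).PosSemidef
  mulVec_one : W.mulVec (fun _ => 1) = fun _ => 1
  ker_eq : LinearMap.ker (1 - W).mulVecLin = Submodule.span ℝ {(fun _ => 1 : Fin m → ℝ)}

/-- The second largest eigenvalue, counted with multiplicity, of a symmetric matrix of size at
least two (`eigenvalues₀` lists the eigenvalues in decreasing order, starting at index `0`). -/
def lambda2 {m : ℕ} (W : Matrix (Fin m) (Fin m) ℝ) : ℝ :=
  if h : W.IsHermitian ∧ 1 < Fintype.card (Fin m) then h.1.eigenvalues₀ ⟨1, h.2⟩ else 0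

/-- One round of local communication: the product `W x`. -/
def mix {m d : ℕ} (W : Matrix (Fin m) (Fin m) ℝ) (x : Stack m d) : Stack m d :=
  fun i => ∑ j, W i j • x j

/-- The momentum parameter of the accelerated gossip. -/
def etaW {m : ℕ} (W : Matrix (Fin m) (Fin m) ℝ) : ℝ := 1 / (1 + √(1 - lambda2 W ^ 2))

/-- The memory of the `FastMix` loop, with the number of communication rounds made so far. -/
structure FastMixState (m d : ℕ) where
  prev : Stack m d
  cur : Stack m d
  rounds : ℕ

/-- The state of `FastMix` after `k` passes of its loop, started at `x`: `prev` is `x^k` and `cur`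
is `x^(k+1)`, where `x^0 = x^1 = x`. -/
def fastMixLoop {m d : ℕ} (W : Matrix (Fin m) (Fin m) ℝ) (x : Stack m d) : ℕ → FastMixState m d
  | 0 => ⟨x, x, 0⟩
  | k + 1 =>
    let st := fastMixLoop W x k
    ⟨st.cur, (1 + etaW W) • mix W st.cur - etaW W • st.prev, st.rounds + 1⟩

/-- The output `x^K` of `FastMix` with `K` passes. -/
def fastMix {m d : ℕ} (W : Matrix (Fin m) (Fin m) ℝ) (K : ℕ) (x : Stack m d) : Stack m d :=
  (fastMixLoop W x K).prev

/-- The number of communication rounds made by `FastMix` with `K` passes. -/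
def fastMixRounds {m d : ℕ} (W : Matrix (Fin m) (Fin m) ℝ) (K : ℕ) (x : Stack m d) : ℕ :=
  (fastMixLoop W x K).rounds

/-- The memory of the algorithm. `grad` holds the local gradients at `x`; `gradCalls` and `rounds`
count the gradients computed by each agent and the communication rounds made so far. -/
structure State (m d : ℕ) where
  x : Stack m d
  y : Stack m d
  z : Stack m d
  s : Stack m d
  grad : Stack m d
  gradCalls : ℕ
  rounds : ℕ

/-- The initialization at the point `x₁`: all agents start at `x₁` and compute one gradient. -/
def initState {m d : ℕ} (f : Fin m → Vec d → ℝ) (x₁ : Vec d) : State m d where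
  x := fun _ => x₁
  y := fun _ => x₁
  z := fun _ => x₁
  s := aggGradient f fun _ => x₁
  grad := aggGradient f fun _ => x₁
  gradCalls := 1
  rounds := 0

/-- One pass of the main loop, with step size `γ`, coupling weight `τ` and `K` passes of
`FastMix`. -/
def step {m d : ℕ} (f : Fin m → Vec d → ℝ) (g : Vec d → ℝ) (W : Matrix (Fin m) (Fin m) ℝ)
    (K : ℕ) (γ τ : ℝ) (st : State m d) : State m d :=
  let x := τ • st.z + (1 - τ) • st.y
  let grad := aggGradient f x
  let sIn := st.s + grad - st.grad
  let s := fastMix W K sIn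
  let zIn := aggProx γ g (st.z - γ • s)
  let z := fastMix W K zIn
  let yIn := τ • z + (1 - τ) • st.y
  { x := x
    y := fastMix W K yIn
    z := z
    s := s
    grad := grad
    gradCalls := st.gradCalls + 1
    rounds := st.rounds + fastMixRounds W K sIn + fastMixRounds W K zIn + fastMixRounds W K yIn }

/-- The algorithm with step sizes `γ t` and weights `τ t`: the state after `n` passes of its main
loop (for `t = 1, …, n`), which holds the iterates with index `n + 1`. -/
def odapg {m d : ℕ} (f : Fin m → Vec d → ℝ) (g : Vec d → ℝ) (W : Matrix (Fin m) (Fin m) ℝ)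
    (K : ℕ) (γ τ : ℕ → ℝ) (x₁ : Vec d) : ℕ → State m d
  | 0 => initState f x₁
  | n + 1 => step f g W K (γ (n + 1)) (τ (n + 1)) (odapg f g W K γ τ x₁ n)

/-- The step size `γ_t = (t + 4) / (2 L c)` with `c = 200`. -/
def stepSize (L : ℝ) (t : ℕ) : ℝ := (t + 4) / (2 * L * 200)

/-- The weight `τ_t = 2 / (t + 4)`. -/
def weight (t : ℕ) : ℝ := 2 / (t + 4)

/-- The number of passes of `FastMix`: `15 / √(1 - λ₂(W))`, rounded up. -/
def mixSteps {m : ℕ} (W : Matrix (Fin m) (Fin m) ℝ) : ℕ := ⌈15 / √(1 - lambda2 W)⌉₊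

/-- The run of the algorithm with the parameters for a general convex regularizer. -/
def convexRun {m d : ℕ} (f : Fin m → Vec d → ℝ) (g : Vec d → ℝ) (W : Matrix (Fin m) (Fin m) ℝ)
    (L : ℝ) (x₁ : Vec d) : ℕ → State m d :=
  odapg f g W (mixSteps W) (stepSize L) weight x₁

end Decentralized

end

/-!
On the averages, the iteration is an accelerated proximal gradient method with an inexact gradient:
gossip preserves averages, so the average of `s` is the average of the gradients taken at the rows
of `x`, and inexactness is measured by the dispersion of the stacks around their averages.

`FastMix` is a linear two-term recurrence along each eigenvector of `W`. For an eigenvalue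
`μ ≤ λ₂(W)` its characteristic roots are not real and have modulus `√η_w`: the recurrence multiplies
a definite quadratic form by `η_w`, so squared norms decay like `η_w ^ K`, up to a constant that
does not depend on `μ`. The number of passes turns this into a contraction factor `10⁻⁴`.

Since `1 / τ_{t+1}² - 1 / τ_{t+1} ≤ 1 / τ_t²`, the usual potential of the accelerated method, with
small multiples of the dispersions added to it, does not increase. The dispersion of `s` is
controlled by the gradient differences that smoothness and convexity make available in the descent
inequality. Hence the suboptimality is `O(τ_n²) = O(1 / n²)`.
-/

noncomputable section

namespace Decentralized

open Filter Finset Set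
open scoped BigOperators Matrix RealInnerProductSpace

section InnerProductSpace

variable {E : Type*} [NormedAddCommGroup E]

theorem le_of_isMinOn_of_uniformConvexOn [NormedSpace ℝ E] {s : Set E} {ψ : ℝ → ℝ} {h : E → ℝ}
    {w u : E} (hh : UniformConvexOn s ψ h) (hmin : IsMinOn h s w) (hw : w ∈ s) (hu : u ∈ s) :
    h w + ψ ‖u - w‖ ≤ h u := by
  have hsegment : ∀ t ∈ Ioo (0 : ℝ) 1, h w + (1 - t) * ψ ‖u - w‖ ≤ h u := by
    rintro t ⟨ht0, ht1⟩
    have hmem := hh.1 hu hw ht0.le (sub_nonneg.2 ht1.le) (by ring)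
    have hconv := hh.2 hu hw ht0.le (sub_nonneg.2 ht1.le) (by ring)
    have hle := (isMinOn_iff.1 hmin _ hmem).trans hconv
    simp only [smul_eq_mul] at hle
    refine le_of_mul_le_mul_left ?_ ht0
    linarith
  have hlim : Tendsto (fun t : ℝ => h w + (1 - t) * ψ ‖u - w‖) (nhdsWithin 0 (Ioi 0))
      (nhds (h w + (1 - 0) * ψ ‖u - w‖)) :=
    Continuous.continuousWithinAt (by fun_prop)
  rw [sub_zero, one_mul] at hlim
  exact le_of_tendsto hlim (eventually_of_mem (Ioo_mem_nhdsGT one_pos) hsegment)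

theorem tendsto_add_sq_norm_sub_cocompact [NormedSpace ℝ E] [FiniteDimensional ℝ E] {h : E → ℝ}
    (hh : ConvexOn ℝ univ h) (x : E) :
    Tendsto (fun w => h w + 1 / 2 * ‖w - x‖ ^ 2) (cocompact E) atTop := by
  have : ProperSpace E := FiniteDimensional.proper_real E
  obtain ⟨l, c, hlc, -⟩ := hh.exists_affine_le_of_lt (𝕜 := ℝ) (mem_univ x) (sub_one_lt (h x))
    isClosed_univ (hh.continuousOn isOpen_univ).lowerSemicontinuousOn
  have hbound : ∀ w, l x + c + ‖w - x‖ * (1 / 2 * ‖w - x‖ - ‖l‖) ≤ h w + 1 / 2 * ‖w - x‖ ^ 2 := by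
    intro w
    have hl : -(‖l‖ * ‖w - x‖) ≤ l w - l x := by
      rw [← map_sub]
      exact (abs_le.1 (l.le_opNorm (w - x))).1
    have hw : l w + c ≤ h w := hlc ⟨w, mem_univ w⟩
    linarith
  have hnorm : Tendsto (fun w => ‖w - x‖) (cocompact E) atTop := by
    simpa only [dist_eq_norm] using tendsto_dist_right_cocompact_atTop x
  refine tendsto_atTop_mono hbound (tendsto_atTop_add_const_left _ _ (hnorm.atTop_mul_atTop₀ ?_))
  exact tendsto_atTop_add_const_right _ _ (hnorm.const_mul_atTop one_half_pos)

variable [InnerProductSpace ℝ E]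

theorem strongConvexOn_add_sq_norm_sub {h : E → ℝ} (hh : ConvexOn ℝ univ h) (x : E) :
    StrongConvexOn univ 1 fun w => h w + 1 / 2 * ‖w - x‖ ^ 2 := by
  rw [strongConvexOn_iff_convex]
  have haffine : ConvexOn ℝ univ fun w => -⟪x, w⟫ + 1 / 2 * ‖x‖ ^ 2 :=
    ((-innerₛₗ ℝ x).convexOn convex_univ).add_const _
  refine (hh.add haffine).congr fun w _ => ?_
  simp only [Pi.add_apply, norm_sub_sq_real, real_inner_comm w x]
  ring

theorem sq_norm_add_le (a b : E) : ‖a + b‖ ^ 2 ≤ 2 * ‖a‖ ^ 2 + 2 * ‖b‖ ^ 2 := by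
  linarith [parallelogram_law_with_norm ℝ a b, mul_self_nonneg ‖a - b‖]

theorem neg_mul_inner_le (γ : ℝ) (a b : E) :
    -(γ * ⟪a, b⟫) ≤ γ ^ 2 * ‖a‖ ^ 2 + 1 / 4 * ‖b‖ ^ 2 := by
  have h : 0 ≤ ‖(2 * γ) • a + b‖ ^ 2 := sq_nonneg _
  rw [norm_add_sq_real, norm_smul, inner_smul_left, mul_pow, Real.norm_eq_abs, sq_abs,
    conj_trivial] at h
  linarith

end InnerProductSpace

section Convex

variable {d : ℕ} {L γ : ℝ} {φ g : Vec d → ℝ}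

theorem IsConvexSmooth.add_sq_norm_gradient_sub_le (h : IsConvexSmooth L φ) (hL : 0 < L)
    (x y : Vec d) :
    φ x + ⟪gradient φ x, y - x⟫ + 1 / (2 * L) * ‖gradient φ y - gradient φ x‖ ^ 2 ≤ φ y := by
  set v := gradient φ y - gradient φ x with hv
  -- a gradient step from `y` for the convex function `φ - ⟪∇φ x, ·⟫`, which `x` minimizes
  have hlower := h.lower x (y - L⁻¹ • v)
  have hupper := h.upper y (y - L⁻¹ • v)
  rw [sub_right_comm, inner_sub_right, inner_smul_right] at hlower
  rw [sub_sub_cancel_left, inner_neg_right, inner_smul_right, sub_sub_cancel, norm_smul, mul_pow,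
    Real.norm_eq_abs, sq_abs] at hupper
  have hinner : L⁻¹ * ⟪gradient φ y, v⟫ - L⁻¹ * ⟪gradient φ x, v⟫ = L⁻¹ * ‖v‖ ^ 2 := by
    rw [← mul_sub, ← inner_sub_left, ← hv, real_inner_self_eq_norm_sq]
  have hquad : L / 2 * (L⁻¹ ^ 2 * ‖v‖ ^ 2) = L⁻¹ * ‖v‖ ^ 2 - 1 / (2 * L) * ‖v‖ ^ 2 := by
    field_simp
    ring
  linarith

theorem IsConvexSmooth.sq_norm_gradient_sub_le_inner (h : IsConvexSmooth L φ) (hL : 0 < L)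
    (x y : Vec d) :
    ‖gradient φ x - gradient φ y‖ ^ 2 ≤ L * ⟪gradient φ x - gradient φ y, x - y⟫ := by
  have hxy := h.add_sq_norm_gradient_sub_le hL x y
  have hyx := h.add_sq_norm_gradient_sub_le hL y x
  rw [norm_sub_rev, ← neg_sub x y, inner_neg_right] at hxy
  have hsum : 1 / L * ‖gradient φ x - gradient φ y‖ ^ 2
      ≤ ⟪gradient φ x - gradient φ y, x - y⟫ := by
    rw [inner_sub_left, show 1 / L = 1 / (2 * L) + 1 / (2 * L) by field_simp; norm_num]
    linarith
  rwa [one_div_mul_eq_div, div_le_iff₀' hL] at hsum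

theorem IsConvexSmooth.norm_gradient_sub_le (h : IsConvexSmooth L φ) (hL : 0 < L)
    (x y : Vec d) : ‖gradient φ x - gradient φ y‖ ≤ L * ‖x - y‖ := by
  rcases (norm_nonneg (gradient φ x - gradient φ y)).eq_or_lt with h0 | h0
  · rw [← h0]
    positivity
  · refine le_of_mul_le_mul_left ?_ h0
    calc ‖gradient φ x - gradient φ y‖ * ‖gradient φ x - gradient φ y‖
        ≤ L * ⟪gradient φ x - gradient φ y, x - y⟫ := by
          rw [← sq]
          exact h.sq_norm_gradient_sub_le_inner hL x y
      _ ≤ L * (‖gradient φ x - gradient φ y‖ * ‖x - y‖) := by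
          gcongr
          exact real_inner_le_norm _ _
      _ = ‖gradient φ x - gradient φ y‖ * (L * ‖x - y‖) := by ring

theorem IsConvexSmooth.le_of_approx_gradient (h : IsConvexSmooth L φ) (hL : 0 < L) {τ : ℝ}
    (hτ0 : 0 ≤ τ) (hτ1 : τ ≤ 1) (x y z u : Vec d) :
    φ (τ • z + (1 - τ) • y) ≤ (1 - τ) * φ y + τ * (φ u + ⟪gradient φ x, z - u⟫)
      + L / 2 * ‖x - (τ • z + (1 - τ) • y)‖ ^ 2
      - (1 - τ) / (2 * L) * ‖gradient φ y - gradient φ x‖ ^ 2 := by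
  have hupper := h.upper x (τ • z + (1 - τ) • y)
  have hy := mul_le_mul_of_nonneg_left (h.add_sq_norm_gradient_sub_le hL x y) (sub_nonneg.2 hτ1)
  have hu := mul_le_mul_of_nonneg_left (h.lower x u) hτ0
  have hsplit : ⟪gradient φ x, τ • z + (1 - τ) • y - x⟫ = (1 - τ) * ⟪gradient φ x, y - x⟫
      + τ * ⟪gradient φ x, u - x⟫ + τ * ⟪gradient φ x, z - u⟫ := by
    simp only [inner_sub_right, inner_add_right, inner_smul_right]
    ring
  have hgap : (1 - τ) * (1 / (2 * L) * ‖gradient φ y - gradient φ x‖ ^ 2)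
      = (1 - τ) / (2 * L) * ‖gradient φ y - gradient φ x‖ ^ 2 := by ring
  linarith

theorem exists_isProx (hg : ConvexOn ℝ univ g) (hγ : 0 ≤ γ) (x : Vec d) :
    ∃ w, IsProx γ g x w := by
  have hγg : ConvexOn ℝ univ fun w => γ * g w := hg.smul hγ
  have hcont : Continuous fun w => γ * g w := continuousOn_univ.1 (hγg.continuousOn isOpen_univ)
  exact Continuous.exists_forall_le (by fun_prop) (tendsto_add_sq_norm_sub_cocompact hγg x)

theorem isProx_prox (hg : ConvexOn ℝ univ g) (hγ : 0 ≤ γ) (x : Vec d) :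
    IsProx γ g x (prox γ g x) :=
  Classical.epsilon_spec (exists_isProx hg hγ x)

theorem IsProx.add_sq_norm_sub_le {x w : Vec d} (h : IsProx γ g x w) (hg : ConvexOn ℝ univ g)
    (hγ : 0 ≤ γ) (u : Vec d) :
    γ * g w + 1 / 2 * ‖w - x‖ ^ 2 + 1 / 2 * ‖u - w‖ ^ 2 ≤ γ * g u + 1 / 2 * ‖u - x‖ ^ 2 :=
  le_of_isMinOn_of_uniformConvexOn (strongConvexOn_add_sq_norm_sub (hg.smul hγ) x)
    (isMinOn_univ_iff.2 h) (mem_univ w) (mem_univ u)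

theorem IsProx.le_of_gradient_step {z s w : Vec d} (h : IsProx γ g (z - γ • s) w)
    (hg : ConvexOn ℝ univ g) (hγ : 0 ≤ γ) (u : Vec d) :
    γ * g w + γ * ⟪s, w - u⟫ + 1 / 2 * ‖w - z‖ ^ 2 + 1 / 2 * ‖w - u‖ ^ 2
      ≤ γ * g u + 1 / 2 * ‖z - u‖ ^ 2 := by
  have hle := h.add_sq_norm_sub_le hg hγ u
  rw [← sub_add, ← sub_add, norm_add_sq_real, norm_add_sq_real, inner_smul_right,
    inner_smul_right, norm_sub_rev u w, norm_sub_rev u z] at hle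
  have hinner : ⟪w - z, s⟫ - ⟪u - z, s⟫ = ⟪s, w - u⟫ := by
    rw [← inner_sub_left, sub_sub_sub_cancel_right, real_inner_comm]
  rw [← hinner]
  linarith

end Convex

section Average

variable {m d : ℕ}

/-- The linear combination of the rows of a stack with weights `v`; for `v` in an orthonormal basis
of `ℝᵐ` it is the coefficient of the stack along `v`. -/
def coeff (v : Fin m → ℝ) : Stack m d →ₗ[ℝ] Vec d := ∑ j, v j • LinearMap.proj j

theorem coeff_apply (v : Fin m → ℝ) (x : Stack m d) : coeff v x = ∑ j, v j • x j := by
  simp only [coeff, LinearMap.sum_apply, LinearMap.smul_apply, LinearMap.proj_apply]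

theorem average_eq_coeff (x : Stack m d) : average x = coeff (fun _ => (m : ℝ)⁻¹) x := by
  rw [coeff_apply, average, Finset.smul_sum]

theorem average_add (x y : Stack m d) : average (x + y) = average x + average y := by
  simp only [average_eq_coeff, map_add]

theorem average_sub (x y : Stack m d) : average (x - y) = average x - average y := by
  simp only [average_eq_coeff, map_sub]

theorem average_smul (c : ℝ) (x : Stack m d) : average (c • x) = c • average x := by
  simp only [average_eq_coeff, map_smul]

theorem average_const [NeZero m] (v : Vec d) : average (fun _ : Fin m => v) = v := by
  rw [average, Fin.sum_const, ← Nat.cast_smul_eq_nsmul ℝ,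
    inv_smul_smul₀ (Nat.cast_ne_zero.2 (NeZero.ne m))]

theorem average_sub_average [NeZero m] (x : Stack m d) : average (x - fun _ => average x) = 0 := by
  rw [average_sub, average_const, sub_self]

theorem inv_mul_sum_eq_expect (a : Fin m → ℝ) : (m : ℝ)⁻¹ * ∑ i, a i = 𝔼 i, a i := by
  rw [Fintype.expect_eq_sum_div_card, Fintype.card_fin, inv_mul_eq_div]

theorem objective_eq_expect (f : Fin m → Vec d → ℝ) (g : Vec d → ℝ) (v : Vec d) :
    objective f g v = 𝔼 i, f i v + g v := by
  rw [objective, inv_mul_sum_eq_expect]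

theorem expect_inner_left (x : Stack m d) (v : Vec d) : 𝔼 i, ⟪x i, v⟫ = ⟪average x, v⟫ := by
  rw [← inv_mul_sum_eq_expect, average, real_inner_smul_left, sum_inner]

theorem expect_inner_sub [NeZero m] (s w : Stack m d) (u : Vec d) :
    𝔼 i, ⟪s i, w i - u⟫
      = ⟪average s, average w - u⟫ + 𝔼 i, ⟪s i - average s, w i - average w⟫ := by
  have hcentered : 𝔼 i, ⟪w i - average w, average s⟫ = 0 := by
    rw [← inner_zero_left (average s), ← average_sub_average w, ← expect_inner_left]
    rfl
  have hsplit : ∀ i, ⟪s i, w i - u⟫ = ⟪s i, average w - u⟫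
      + ⟪s i - average s, w i - average w⟫ + ⟪w i - average w, average s⟫ := fun i => by
    rw [real_inner_comm (average s) (w i - average w), add_assoc, ← inner_add_left, sub_add_cancel,
      ← inner_add_right, add_comm, sub_add_sub_cancel]
  simp only [hsplit, expect_add_distrib, hcentered, expect_inner_left, add_zero]

theorem map_average_le_expect [NeZero m] {g : Vec d → ℝ} (hg : ConvexOn ℝ univ g)
    (x : Stack m d) : g (average x) ≤ 𝔼 i, g (x i) := by
  have hweights : ∑ _i : Fin m, (m : ℝ)⁻¹ = 1 := by
    rw [Fin.sum_const, nsmul_eq_mul, mul_inv_cancel₀ (Nat.cast_ne_zero.2 (NeZero.ne m))]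
  rw [average, Finset.smul_sum, ← inv_mul_sum_eq_expect, Finset.mul_sum]
  exact hg.map_sum_le (fun _ _ => by positivity) hweights fun _ _ => mem_univ _

end Average

section Dispersion

variable {m d : ℕ}

/-- The mean squared distance of the rows of `x` to `v`. -/
def meanSqDist (x : Stack m d) (v : Vec d) : ℝ := 𝔼 i, ‖x i - v‖ ^ 2

/-- The mean squared distance of the rows of `x` to their average: the squared consensus error per
agent. -/
def dispersion (x : Stack m d) : ℝ := meanSqDist x (average x)

theorem dispersion_eq_inv_mul (x : Stack m d) :
    dispersion x = (m : ℝ)⁻¹ * consensusErrorSq x :=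
  (inv_mul_sum_eq_expect _).symm

theorem meanSqDist_nonneg (x : Stack m d) (v : Vec d) : 0 ≤ meanSqDist x v :=
  expect_nonneg fun _ _ => sq_nonneg _

theorem dispersion_le_consensusErrorSq (x : Stack m d) : dispersion x ≤ consensusErrorSq x := by
  rw [dispersion_eq_inv_mul]
  exact mul_le_of_le_one_left (Finset.sum_nonneg fun _ _ => sq_nonneg _) (Nat.cast_inv_le_one m)

theorem dispersion_nonneg (x : Stack m d) : 0 ≤ dispersion x := meanSqDist_nonneg _ _

theorem meanSqDist_eq_add_dispersion [NeZero m] (x : Stack m d) (v : Vec d) :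
    meanSqDist x v = ‖average x - v‖ ^ 2 + dispersion x := by
  have h := expect_inner_sub (x - fun _ => v) x v
  rw [average_sub, average_const] at h
  simp only [Pi.sub_apply, sub_sub_sub_cancel_right, real_inner_self_eq_norm_sq] at h
  exact h

theorem dispersion_le_meanSqDist [NeZero m] (x : Stack m d) (v : Vec d) :
    dispersion x ≤ meanSqDist x v := by
  rw [meanSqDist_eq_add_dispersion]
  exact le_add_of_nonneg_left (sq_nonneg _)

theorem meanSqDist_const [NeZero m] (w v : Vec d) :
    meanSqDist (fun _ : Fin m => w) v = ‖w - v‖ ^ 2 :=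
  Fintype.expect_const _

theorem dispersion_const [NeZero m] (v : Vec d) : dispersion (fun _ : Fin m => v) = 0 := by
  rw [dispersion, average_const, meanSqDist_const, sub_self, norm_zero, zero_pow two_ne_zero]

theorem dispersion_add_le (x y : Stack m d) :
    dispersion (x + y) ≤ 2 * dispersion x + 2 * dispersion y := by
  simp only [dispersion, meanSqDist, mul_expect, ← expect_add_distrib, average_add, Pi.add_apply,
    add_sub_add_comm]
  exact expect_le_expect fun i _ => sq_norm_add_le _ _

theorem dispersion_smul (c : ℝ) (x : Stack m d) : dispersion (c • x) = c ^ 2 * dispersion x := by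
  simp only [dispersion, meanSqDist, mul_expect, average_smul, Pi.smul_apply, ← smul_sub,
    norm_smul, mul_pow, Real.norm_eq_abs, sq_abs]

theorem dispersion_combo_le {τ : ℝ} (hτ0 : 0 ≤ τ) (hτ1 : τ ≤ 1) (z y : Stack m d) :
    dispersion (τ • z + (1 - τ) • y) ≤ 2 * (τ ^ 2 * dispersion z) + 2 * dispersion y := by
  have hsq : (1 - τ) ^ 2 * dispersion y ≤ dispersion y :=
    mul_le_of_le_one_left (dispersion_nonneg y)
      (pow_le_one₀ (sub_nonneg.2 hτ1) (sub_le_self 1 hτ0))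
  calc dispersion (τ • z + (1 - τ) • y)
      ≤ 2 * (τ ^ 2 * dispersion z) + 2 * ((1 - τ) ^ 2 * dispersion y) := by
        rw [← dispersion_smul, ← dispersion_smul]
        exact dispersion_add_le _ _
    _ ≤ 2 * (τ ^ 2 * dispersion z) + 2 * dispersion y := by gcongr

end Dispersion

section Spectrum

variable {m d : ℕ} {G : SimpleGraph (Fin m)} {W : Matrix (Fin m) (Fin m) ℝ}

theorem exists_eigenvalues_eq_lambda2 (hW : W.IsHermitian) (hm : 2 ≤ m) :
    ∃ i₀ i₁, i₀ ≠ i₁ ∧ hW.eigenvalues i₁ = lambda2 W ∧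
      (∀ i, hW.eigenvalues i ≤ hW.eigenvalues i₀) ∧ ∀ i ≠ i₀, hW.eigenvalues i ≤ lambda2 W := by
  have hcard : 1 < Fintype.card (Fin m) := by rwa [Fintype.card_fin]
  have hlambda : lambda2 W = hW.eigenvalues₀ ⟨1, hcard⟩ := dif_pos ⟨hW, hcard⟩
  obtain ⟨e, he⟩ : ∃ e : Fin (Fintype.card (Fin m)) ≃ Fin m,
      ∀ k, hW.eigenvalues (e k) = hW.eigenvalues₀ k :=
    ⟨_, fun k => congrArg hW.eigenvalues₀ (Equiv.symm_apply_apply _ k)⟩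
  refine ⟨e ⟨0, by lia⟩, e ⟨1, hcard⟩, ?_, ?_, e.forall_congr_right.1 fun k => ?_,
    e.forall_congr_right.1 fun k hk => ?_⟩
  · simp only [ne_eq, e.injective.eq_iff, Fin.mk.injEq, zero_ne_one, not_false_eq_true]
  · rw [he, hlambda]
  · rw [he, he]
    exact hW.eigenvalues₀_antitone (Fin.mk_le_of_le_val (Nat.zero_le _))
  · rw [he, hlambda]
    refine hW.eigenvalues₀_antitone (Fin.mk_le_of_le_val (Nat.one_le_iff_ne_zero.2 fun h0 => hk ?_))
    exact congrArg e (Fin.ext h0)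

theorem IsMixingMatrix.isHermitian (hW : IsMixingMatrix G W) : W.IsHermitian := hW.posSemidef.1

namespace IsMixingMatrix

theorem eq_const_of_mulVec_eq (hW : IsMixingMatrix G W) {v : Fin m → ℝ} (hv : W *ᵥ v = v) :
    ∃ c, v = fun _ => c := by
  have hker : v ∈ LinearMap.ker (1 - W).mulVecLin := by
    rw [LinearMap.mem_ker, Matrix.mulVecLin_apply, Matrix.sub_mulVec, Matrix.one_mulVec, hv,
      sub_self]
  rw [hW.ker_eq, Submodule.mem_span_singleton] at hker
  obtain ⟨c, rfl⟩ := hker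
  exact ⟨c, funext fun _ => mul_one c⟩

theorem eigenvalues_le_one (hW : IsMixingMatrix G W) (i : Fin m) :
    hW.isHermitian.eigenvalues i ≤ 1 := by
  set v := hW.isHermitian.eigenvectorBasis i with hv
  have hnorm : v.ofLp ⬝ᵥ v.ofLp = 1 := by
    have h := real_inner_self_eq_norm_sq v
    rwa [hW.isHermitian.eigenvectorBasis.orthonormal.1 i, one_pow,
      EuclideanSpace.inner_eq_star_dotProduct, star_trivial] at h
  have h := hW.le_one.dotProduct_mulVec_nonneg v.ofLp
  rw [star_trivial, Matrix.sub_mulVec, Matrix.one_mulVec, hv,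
    hW.isHermitian.mulVec_eigenvectorBasis, ← hv, dotProduct_sub, dotProduct_smul, hnorm,
    smul_eq_mul, mul_one] at h
  exact sub_nonneg.1 h

theorem exists_eigenvalues_eq_one [NeZero m] (hW : IsMixingMatrix G W) :
    ∃ i, hW.isHermitian.eigenvalues i = 1 := by
  have hone : Module.End.HasEigenvector (Matrix.toLin' W) 1 fun _ => 1 := by
    refine ⟨Module.End.mem_eigenspace_iff.2 ?_, Function.const_ne_zero.2 one_ne_zero⟩
    rw [Matrix.toLin'_apply, hW.mulVec_one, one_smul]
  have hmem := (Module.End.hasEigenvalue_of_hasEigenvector hone).mem_spectrum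
  rwa [Matrix.spectrum_toLin', hW.isHermitian.spectrum_real_eq_range_eigenvalues] at hmem

theorem exists_eigenvectorBasis_eq_const (hW : IsMixingMatrix G W) {i : Fin m}
    (hi : hW.isHermitian.eigenvalues i = 1) :
    ∃ c, (hW.isHermitian.eigenvectorBasis i).ofLp = fun _ => c :=
  hW.eq_const_of_mulVec_eq (by rw [hW.isHermitian.mulVec_eigenvectorBasis, hi, one_smul])

theorem sum_eigenvectorBasis_eq_zero (hW : IsMixingMatrix G W) {i : Fin m}
    (hi : hW.isHermitian.eigenvalues i ≠ 1) : ∑ j, hW.isHermitian.eigenvectorBasis i j = 0 := by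
  set v := (hW.isHermitian.eigenvectorBasis i).ofLp with hv
  have hsum : W *ᵥ v ⬝ᵥ 1 = v ⬝ᵥ 1 := by
    rw [← Matrix.vecMul_transpose, hW.symm.eq, ← Matrix.dotProduct_mulVec]
    exact congrArg (v ⬝ᵥ ·) hW.mulVec_one
  rw [hv, hW.isHermitian.mulVec_eigenvectorBasis, ← hv, smul_dotProduct, smul_eq_mul,
    mul_left_eq_self₀, dotProduct_one] at hsum
  exact hsum.resolve_left hi

theorem eigenvalues_le_lambda2 (hW : IsMixingMatrix G W) (hm : 2 ≤ m) {i : Fin m}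
    (hi : hW.isHermitian.eigenvalues i ≠ 1) : hW.isHermitian.eigenvalues i ≤ lambda2 W := by
  have : NeZero m := ⟨by lia⟩
  obtain ⟨i₀, -, -, -, hmax, hle⟩ := exists_eigenvalues_eq_lambda2 hW.isHermitian hm
  obtain ⟨k, hk⟩ := hW.exists_eigenvalues_eq_one
  refine hle i fun hi₀ => hi ((hW.eigenvalues_le_one i).antisymm ?_)
  rw [hi₀, ← hk]
  exact hmax k

theorem lambda2_nonneg (hW : IsMixingMatrix G W) (hm : 2 ≤ m) : 0 ≤ lambda2 W := by
  obtain ⟨-, i₁, -, h, -⟩ := exists_eigenvalues_eq_lambda2 hW.isHermitian hm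
  rw [← h]
  exact hW.posSemidef.eigenvalues_nonneg i₁

theorem lambda2_lt_one (hW : IsMixingMatrix G W) (hm : 2 ≤ m) : lambda2 W < 1 := by
  have : NeZero m := ⟨by lia⟩
  obtain ⟨i₀, i₁, hne, h, hmax, -⟩ := exists_eigenvalues_eq_lambda2 hW.isHermitian hm
  rw [← h]
  refine (hW.eigenvalues_le_one i₁).lt_of_ne fun h₁ => ?_
  -- otherwise the orthogonal unit eigenvectors with indices `i₀` and `i₁` would both be constant
  have h₀ : hW.isHermitian.eigenvalues i₀ = 1 :=
    (hW.eigenvalues_le_one i₀).antisymm (h₁ ▸ hmax i₁)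
  obtain ⟨a, ha⟩ := hW.exists_eigenvectorBasis_eq_const h₀
  obtain ⟨c, hc⟩ := hW.exists_eigenvectorBasis_eq_const h₁
  have hne_zero := hW.isHermitian.eigenvectorBasis.orthonormal.ne_zero
  have ha0 : a ≠ 0 := by
    rintro rfl
    exact hne_zero i₀ (WithLp.ofLp_injective 2 ha)
  have hc0 : c ≠ 0 := by
    rintro rfl
    exact hne_zero i₁ (WithLp.ofLp_injective 2 hc)
  have horth : ⟪hW.isHermitian.eigenvectorBasis i₀, hW.isHermitian.eigenvectorBasis i₁⟫ = 0 :=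
    hW.isHermitian.eigenvectorBasis.orthonormal.2 hne
  rw [EuclideanSpace.inner_eq_star_dotProduct, star_trivial, ha, hc, dotProduct, Fin.sum_const,
    nsmul_eq_mul] at horth
  exact mul_ne_zero (Nat.cast_ne_zero.2 (NeZero.ne m)) (mul_ne_zero hc0 ha0) horth

end IsMixingMatrix

theorem coeff_mix (hW : W.IsSymm) {v : Fin m → ℝ} {μ : ℝ} (hv : W *ᵥ v = μ • v)
    (x : Stack m d) : coeff v (mix W x) = μ • coeff v x := by
  have hcolumn : ∀ k, ∑ j, v j * W j k = (μ • v) k := fun k => by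
    rw [← hv, ← Matrix.vecMul_transpose, hW.eq]
    rfl
  simp only [coeff_apply, mix, Finset.smul_sum, smul_smul]
  rw [Finset.sum_comm]
  simp only [← Finset.sum_smul, hcolumn, Pi.smul_apply, smul_eq_mul]

theorem sum_sq_norm_coeff (b : OrthonormalBasis (Fin m) ℝ (EuclideanSpace ℝ (Fin m)))
    (x : Stack m d) : ∑ i, ‖coeff (b i) x‖ ^ 2 = ∑ j, ‖x j‖ ^ 2 := by
  have hparseval : ∀ a, ∑ i, coeff (b i) x a ^ 2 = ∑ j, x j a ^ 2 := fun a => by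
    have h := b.sum_sq_norm_inner_right (WithLp.toLp 2 fun j => x j a)
    rw [EuclideanSpace.real_norm_sq_eq] at h
    simpa only [coeff_apply, WithLp.ofLp_sum, WithLp.ofLp_smul, Finset.sum_apply, Pi.smul_apply,
      smul_eq_mul, PiLp.inner_apply, RCLike.inner_apply, conj_trivial, Real.norm_eq_abs, sq_abs,
      mul_comm] using h
  simp only [EuclideanSpace.real_norm_sq_eq]
  rw [Finset.sum_comm, Finset.sum_congr rfl fun a _ => hparseval a, Finset.sum_comm]

theorem IsMixingMatrix.consensusErrorSq_eq [NeZero m] (hW : IsMixingMatrix G W) (x : Stack m d) :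
    consensusErrorSq x = ∑ i with hW.isHermitian.eigenvalues i ≠ 1,
      ‖coeff (hW.isHermitian.eigenvectorBasis i) x‖ ^ 2 := by
  have hcoeff : ∀ i, ‖coeff (hW.isHermitian.eigenvectorBasis i) (x - fun _ => average x)‖ ^ 2
      = if hW.isHermitian.eigenvalues i ≠ 1
        then ‖coeff (hW.isHermitian.eigenvectorBasis i) x‖ ^ 2 else 0 := fun i => by
    split_ifs with hi
    · rw [map_sub, coeff_apply _ fun _ => average x, ← Finset.sum_smul,
        hW.sum_eigenvectorBasis_eq_zero hi, zero_smul, sub_zero]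
    · obtain ⟨c, hc⟩ := hW.exists_eigenvectorBasis_eq_const (not_not.1 hi)
      have hsum := (smul_eq_zero.1 (average_sub_average x)).resolve_left
        (inv_ne_zero (Nat.cast_ne_zero.2 (NeZero.ne m)))
      rw [coeff_apply, hc, ← Finset.smul_sum, hsum, smul_zero, norm_zero, zero_pow two_ne_zero]
  rw [Finset.sum_filter, ← Finset.sum_congr rfl fun i _ => hcoeff i, sum_sq_norm_coeff]
  rfl

end Spectrum

section FastMix

variable {m d : ℕ} {G : SimpleGraph (Fin m)} {W : Matrix (Fin m) (Fin m) ℝ}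

theorem fastMixRounds_eq (W : Matrix (Fin m) (Fin m) ℝ) (K : ℕ) (x : Stack m d) :
    fastMixRounds W K x = K := by
  induction K with
  | zero => rfl
  | succ k ih => exact congrArg (· + 1) ih

theorem coeff_fastMix_add_two (hW : W.IsSymm) {v : Fin m → ℝ} {μ : ℝ} (hv : W *ᵥ v = μ • v)
    (x : Stack m d) (k : ℕ) :
    coeff v (fastMix W (k + 2) x)
      = ((1 + etaW W) * μ) • coeff v (fastMix W (k + 1) x) - etaW W • coeff v (fastMix W k x) := by
  change coeff v ((1 + etaW W) • mix W (fastMix W (k + 1) x) - etaW W • fastMix W k x) = _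
  rw [map_sub, map_smul, map_smul, coeff_mix hW hv, smul_smul]

theorem IsMixingMatrix.average_fastMix (hW : IsMixingMatrix G W) (K : ℕ) (x : Stack m d) :
    average (fastMix W K x) = average x := by
  have hfixed : W *ᵥ (fun _ => (m : ℝ)⁻¹) = (1 : ℝ) • fun _ => (m : ℝ)⁻¹ := by
    have hsmul : (fun _ : Fin m => (m : ℝ)⁻¹) = (m : ℝ)⁻¹ • fun _ => 1 :=
      funext fun _ => (mul_one _).symm
    rw [hsmul, Matrix.mulVec_smul, hW.mulVec_one, one_smul]
  induction K using Nat.twoStepInduction with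
  | zero => rfl
  | one => rfl
  | more k ih₀ ih₁ =>
    rw [average_eq_coeff, coeff_fastMix_add_two hW.symm hfixed, ← average_eq_coeff,
      ← average_eq_coeff, ih₀, ih₁]
    module

theorem mul_sq_norm_le_of_linear_recurrence {E : Type*} [NormedAddCommGroup E]
    [InnerProductSpace ℝ E] {u : ℕ → E} {p η : ℝ} (h₀ : u 1 = u 0)
    (hu : ∀ k, u (k + 2) = p • u (k + 1) - η • u k) (k : ℕ) :
    (η - p ^ 2 / 4) * ‖u k‖ ^ 2 ≤ η ^ k * ((1 + η - p) * ‖u 0‖ ^ 2) := by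
  -- the recurrence multiplies this quadratic form by `η`
  have hform : ∀ k, ‖u (k + 1)‖ ^ 2 - p * ⟪u (k + 1), u k⟫ + η * ‖u k‖ ^ 2
      = η ^ k * ((1 + η - p) * ‖u 0‖ ^ 2) := by
    intro k
    induction k with
    | zero =>
      rw [h₀, real_inner_self_eq_norm_sq]
      ring
    | succ k ih =>
      rw [pow_succ' η, mul_assoc, ← ih, hu, norm_sub_sq_real, norm_smul, norm_smul, inner_sub_left,
        real_inner_smul_left, real_inner_smul_left, real_inner_smul_left, real_inner_smul_right,
        real_inner_self_eq_norm_sq, mul_pow, mul_pow, Real.norm_eq_abs, Real.norm_eq_abs, sq_abs,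
        sq_abs, real_inner_comm (u (k + 1)) (u k)]
      ring
  have hsq : 0 ≤ ‖u (k + 1) - (p / 2) • u k‖ ^ 2 := sq_nonneg _
  rw [norm_sub_sq_real, norm_smul, real_inner_smul_right, mul_pow, Real.norm_eq_abs, sq_abs] at hsq
  rw [← hform]
  linarith

theorem momentum_discriminant {c t : ℝ} (hc : 0 ≤ c) (ht0 : 0 ≤ t) (ht1 : t ≤ 1)
    (htc : t ^ 2 ≤ 1 - c ^ 2) :
    1 + 1 / (1 + c) - (1 + 1 / (1 + c)) * t
      ≤ 3 * (1 / (1 + c) - ((1 + 1 / (1 + c)) * t) ^ 2 / 4) := by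
  have hgap : 3 * (1 / (1 + c) - ((1 + 1 / (1 + c)) * t) ^ 2 / 4)
      - (1 + 1 / (1 + c) - (1 + 1 / (1 + c)) * t)
      = (1 - c ^ 2 - t ^ 2 + (2 + c) * (1 + c) * (t * (1 - t)) + c ^ 2 * t ^ 2 / 4)
        / (1 + c) ^ 2 := by
    field_simp
    ring
  have := sub_nonneg.2 htc
  have := sub_nonneg.2 ht1
  rw [← sub_nonneg, hgap]
  positivity

theorem etaW_pos : 0 < etaW W := by
  unfold etaW
  positivity

theorem IsMixingMatrix.consensusErrorSq_fastMix_le (hW : IsMixingMatrix G W) (hm : 2 ≤ m) (K : ℕ)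
    (x : Stack m d) :
    consensusErrorSq (fastMix W K x) ≤ 3 * etaW W ^ K * consensusErrorSq x := by
  have : NeZero m := ⟨by lia⟩
  rw [hW.consensusErrorSq_eq, hW.consensusErrorSq_eq, Finset.mul_sum]
  refine Finset.sum_le_sum fun i hi => ?_
  have hi := (Finset.mem_filter.1 hi).2
  have hμ0 := hW.posSemidef.eigenvalues_nonneg i
  have hμl := hW.eigenvalues_le_lambda2 hm hi
  set b := hW.isHermitian.eigenvectorBasis i
  set μ := hW.isHermitian.eigenvalues i
  have hl1 := hW.lambda2_lt_one hm
  have hμ2 : μ ^ 2 ≤ lambda2 W ^ 2 := pow_le_pow_left₀ hμ0 hμl 2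
  have hl2 : lambda2 W ^ 2 ≤ 1 := pow_le_one₀ (hμ0.trans hμl) hl1.le
  have hdisc := momentum_discriminant (Real.sqrt_nonneg (1 - lambda2 W ^ 2)) hμ0
    (hμl.trans hl1.le) (by rwa [Real.sq_sqrt (sub_nonneg.2 hl2), sub_sub_cancel])
  rw [← etaW] at hdisc
  have hpos : 0 < 1 + etaW W - (1 + etaW W) * μ := by
    rw [← mul_one_sub]
    exact mul_pos (add_pos one_pos etaW_pos) (sub_pos.2 (hμl.trans_lt hl1))
  have hgrowth := mul_sq_norm_le_of_linear_recurrence (u := fun k => coeff b (fastMix W k x)) rfl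
    (coeff_fastMix_add_two hW.symm (hW.isHermitian.mulVec_eigenvectorBasis i) x) K
  refine le_of_mul_le_mul_left ?_ hpos
  calc (1 + etaW W - (1 + etaW W) * μ) * ‖coeff b (fastMix W K x)‖ ^ 2
      ≤ 3 * (etaW W - ((1 + etaW W) * μ) ^ 2 / 4) * ‖coeff b (fastMix W K x)‖ ^ 2 := by gcongr
    _ = 3 * ((etaW W - ((1 + etaW W) * μ) ^ 2 / 4) * ‖coeff b (fastMix W K x)‖ ^ 2) := by ring
    _ ≤ 3 * (etaW W ^ K * ((1 + etaW W - (1 + etaW W) * μ) * ‖coeff b x‖ ^ 2)) := by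
      gcongr 3 * ?_
      exact hgrowth
    _ = _ := by ring

theorem two_le_one_add_rpow_inv {s : ℝ} (hs0 : 0 < s) (hs1 : s ≤ 1) : 2 ≤ (1 + s) ^ s⁻¹ := by
  have h := one_add_mul_self_le_rpow_one_add (by linarith : -1 ≤ s) ((one_le_inv₀ hs0).2 hs1)
  rwa [inv_mul_cancel₀ hs0.ne', one_add_one_eq_two] at h

theorem etaW_pow_mixSteps_le (hl0 : 0 ≤ lambda2 W) (hl1 : lambda2 W < 1) :
    etaW W ^ mixSteps W ≤ 1 / 2 ^ 15 := by
  set s := √(1 - lambda2 W)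
  have hs0 : 0 < s := Real.sqrt_pos.2 (sub_pos.2 hl1)
  have hs1 : s ≤ 1 := Real.sqrt_le_one.2 (sub_le_self 1 hl0)
  have hsc : s ≤ √(1 - lambda2 W ^ 2) :=
    Real.sqrt_le_sqrt (sub_le_sub_left (pow_le_of_le_one hl0 hl1.le two_ne_zero) 1)
  have hpow : (2 : ℝ) ^ 15 ≤ (1 + s) ^ mixSteps W :=
    calc (2 : ℝ) ^ 15 ≤ ((1 + s) ^ s⁻¹) ^ 15 := by
          gcongr
          exact two_le_one_add_rpow_inv hs0 hs1
      _ = (1 + s) ^ (15 / s) := by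
        rw [← Real.rpow_mul_natCast (by positivity), Nat.cast_ofNat, inv_mul_eq_div]
      _ ≤ (1 + s) ^ (mixSteps W : ℝ) :=
        Real.rpow_le_rpow_of_exponent_le (le_add_of_nonneg_right hs0.le) (Nat.le_ceil _)
      _ = (1 + s) ^ mixSteps W := Real.rpow_natCast _ _
  calc etaW W ^ mixSteps W ≤ (1 / (1 + s)) ^ mixSteps W := by
        unfold etaW
        gcongr
    _ = 1 / (1 + s) ^ mixSteps W := one_div_pow _ _
    _ ≤ 1 / 2 ^ 15 := by gcongr

theorem IsMixingMatrix.dispersion_fastMix_le (hW : IsMixingMatrix G W) (hm : 2 ≤ m)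
    (x : Stack m d) : dispersion (fastMix W (mixSteps W) x) ≤ 1 / 10000 * dispersion x := by
  have hη := etaW_pow_mixSteps_le (hW.lambda2_nonneg hm) (hW.lambda2_lt_one hm)
  have hρ : 3 * etaW W ^ mixSteps W ≤ 1 / 10000 := by linarith
  have hx := dispersion_nonneg x
  rw [dispersion_eq_inv_mul] at hx
  rw [dispersion_eq_inv_mul, dispersion_eq_inv_mul]
  calc (m : ℝ)⁻¹ * consensusErrorSq (fastMix W (mixSteps W) x)
      ≤ (m : ℝ)⁻¹ * (3 * etaW W ^ mixSteps W * consensusErrorSq x) := by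
        gcongr
        exact hW.consensusErrorSq_fastMix_le hm _ x
    _ = 3 * etaW W ^ mixSteps W * ((m : ℝ)⁻¹ * consensusErrorSq x) := by ring
    _ ≤ 1 / 10000 * ((m : ℝ)⁻¹ * consensusErrorSq x) := by gcongr

theorem natCeil_div_le {C s : ℝ} (hC : 0 ≤ C) (hs0 : 0 < s) (hs1 : s ≤ 1) :
    (⌈C / s⌉₊ : ℝ) ≤ (C + 1) / s :=
  calc (⌈C / s⌉₊ : ℝ) ≤ C / s + 1 := (Nat.ceil_lt_add_one (by positivity)).le
    _ ≤ C / s + 1 / s := by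
      gcongr
      exact (one_le_div hs0).2 hs1
    _ = (C + 1) / s := (add_div C 1 s).symm

theorem IsMixingMatrix.mixSteps_le (hW : IsMixingMatrix G W) (hm : 2 ≤ m) :
    mixSteps W ≤ 16 / √(1 - lambda2 W) :=
  (natCeil_div_le (C := 15) (by norm_num) (Real.sqrt_pos.2 (sub_pos.2 (hW.lambda2_lt_one hm)))
    (Real.sqrt_le_one.2 (sub_le_self 1 (hW.lambda2_nonneg hm)))).trans_eq (by norm_num)

end FastMix

section Step

variable {m d : ℕ} {G : SimpleGraph (Fin m)} {W : Matrix (Fin m) (Fin m) ℝ}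
  {f : Fin m → Vec d → ℝ} {g : Vec d → ℝ} {K : ℕ} {L γ τ : ℝ}

/-- The mean squared distance between the local gradients at the common point `v` and those at the
rows of `x`. -/
def meanSqGradDist (f : Fin m → Vec d → ℝ) (v : Vec d) (x : Stack m d) : ℝ :=
  𝔼 i, ‖gradient (f i) v - gradient (f i) (x i)‖ ^ 2

theorem meanSqGradDist_nonneg (v : Vec d) (x : Stack m d) : 0 ≤ meanSqGradDist f v x :=
  expect_nonneg fun _ _ => sq_nonneg _

theorem meanSqGradDist_le (hL : 0 < L) (hf : ∀ i, IsConvexSmooth L (f i)) (v : Vec d)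
    (x : Stack m d) : meanSqGradDist f v x ≤ L ^ 2 * meanSqDist x v := by
  simp only [meanSqGradDist, meanSqDist, mul_expect, ← mul_pow]
  refine expect_le_expect fun i _ => pow_le_pow_left₀ (norm_nonneg _) ?_ 2
  rw [norm_sub_rev (x i)]
  exact (hf i).norm_gradient_sub_le hL v (x i)

theorem dispersion_aggGradient_sub_le [NeZero m] (v : Vec d) (x x' : Stack m d) :
    dispersion (aggGradient f x' - aggGradient f x)
      ≤ 2 * meanSqGradDist f v x' + 2 * meanSqGradDist f v x := by
  refine (dispersion_le_meanSqDist _ 0).trans ?_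
  simp only [meanSqDist, meanSqGradDist, mul_expect, ← expect_add_distrib, sub_zero]
  refine expect_le_expect fun i _ => ?_
  rw [norm_sub_rev (gradient (f i) v) (gradient (f i) (x' i)), Pi.sub_apply,
    ← sub_add_sub_cancel _ (gradient (f i) v)]
  exact sq_norm_add_le _ _

theorem average_prox_le [NeZero m] (hg : ConvexOn ℝ univ g) (hγ : 0 ≤ γ) {z s w : Stack m d}
    (hw : ∀ i, IsProx γ g (z i - γ • s i) (w i)) (u : Vec d) :
    γ * g (average w) + γ * ⟪average s, average w - u⟫ + 1 / 2 * ‖average w - average z‖ ^ 2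
        + 1 / 2 * ‖average w - u‖ ^ 2 + 1 / 4 * dispersion w
      ≤ γ * g u + 1 / 2 * ‖average z - u‖ ^ 2 + 1 / 2 * dispersion z + γ ^ 2 * dispersion s := by
  have hlocal : γ * 𝔼 i, g (w i) + γ * 𝔼 i, ⟪s i, w i - u⟫ + 1 / 2 * meanSqDist (w - z) 0
      + 1 / 2 * meanSqDist w u ≤ γ * g u + 1 / 2 * meanSqDist z u := by
    rw [← Fintype.expect_const (ι := Fin m) (γ * g u)]
    simp only [meanSqDist, mul_expect, ← expect_add_distrib, sub_zero, Pi.sub_apply]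
    exact expect_le_expect fun i _ => (hw i).le_of_gradient_step hg hγ u
  have hcross : -(γ * 𝔼 i, ⟪s i - average s, w i - average w⟫)
      ≤ γ ^ 2 * dispersion s + 1 / 4 * dispersion w := by
    simp only [dispersion, meanSqDist, mul_expect, ← expect_add_distrib, ← expect_neg_distrib]
    exact expect_le_expect fun i _ => neg_mul_inner_le _ _ _
  have hjensen := mul_le_mul_of_nonneg_left (map_average_le_expect hg w) hγ
  have hdist : ‖average w - average z‖ ^ 2 ≤ meanSqDist (w - z) 0 := by
    rw [meanSqDist_eq_add_dispersion, average_sub, sub_zero]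
    exact le_add_of_nonneg_right (dispersion_nonneg _)
  rw [expect_inner_sub, meanSqDist_eq_add_dispersion w, meanSqDist_eq_add_dispersion z] at hlocal
  linarith

theorem expect_smooth_le (hL : 0 < L) (hf : ∀ i, IsConvexSmooth L (f i)) (hτ0 : 0 ≤ τ)
    (hτ1 : τ ≤ 1) (x : Stack m d) (y z u : Vec d) :
    𝔼 i, f i (τ • z + (1 - τ) • y)
      ≤ (1 - τ) * 𝔼 i, f i y + τ * (𝔼 i, f i u + ⟪average (aggGradient f x), z - u⟫)
        + L / 2 * meanSqDist x (τ • z + (1 - τ) • y)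
        - (1 - τ) / (2 * L) * meanSqGradDist f y x := by
  simp only [← expect_inner_left, meanSqDist, meanSqGradDist, mul_expect, ← expect_add_distrib,
    ← expect_sub_distrib]
  exact expect_le_expect fun i _ => (hf i).le_of_approx_gradient hL hτ0 hτ1 (x i) y z u

/-- The gradient-tracking invariant: the stored gradients are those at `x`, and the average of `s`
is the average gradient. -/
structure IsTracking (f : Fin m → Vec d → ℝ) (st : State m d) : Prop where
  grad_eq : st.grad = aggGradient f st.x
  average_s : average st.s = average (aggGradient f st.x)

/-- The rows obtained in one pass by the proximal steps, before they are mixed into the new `z`. -/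
def proxStack (f : Fin m → Vec d → ℝ) (g : Vec d → ℝ) (W : Matrix (Fin m) (Fin m) ℝ) (K : ℕ)
    (γ τ : ℝ) (st : State m d) : Stack m d :=
  aggProx γ g (st.z - γ • (step f g W K γ τ st).s)

theorem IsTracking.step (hW : IsMixingMatrix G W) {st : State m d} (h : IsTracking f st) :
    IsTracking f (step f g W K γ τ st) where
  grad_eq := rfl
  average_s := by
    change average (fastMix W K (st.s + aggGradient f _ - st.grad)) = _
    rw [hW.average_fastMix, average_sub, average_add, h.average_s, h.grad_eq, add_sub_cancel_left]
    rfl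

theorem average_step_x (st : State m d) :
    average (step f g W K γ τ st).x = τ • average st.z + (1 - τ) • average st.y := by
  rw [← average_smul, ← average_smul, ← average_add]
  rfl

theorem average_step_y (hW : IsMixingMatrix G W) (st : State m d) :
    average (step f g W K γ τ st).y
      = τ • average (step f g W K γ τ st).z + (1 - τ) • average st.y := by
  rw [← average_smul, ← average_smul, ← average_add]
  exact hW.average_fastMix _ _

theorem average_step_z (hW : IsMixingMatrix G W) (st : State m d) :
    average (step f g W K γ τ st).z = average (proxStack f g W K γ τ st) :=
  hW.average_fastMix _ _

theorem meanSqDist_step_x [NeZero m] (hW : IsMixingMatrix G W) (st : State m d) :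
    meanSqDist (step f g W K γ τ st).x (average (step f g W K γ τ st).y)
      = τ ^ 2 * ‖average (step f g W K γ τ st).z - average st.z‖ ^ 2
        + dispersion (step f g W K γ τ st).x := by
  rw [meanSqDist_eq_add_dispersion, average_step_x, average_step_y hW, add_sub_add_right_eq_sub,
    ← smul_sub, norm_smul, mul_pow, Real.norm_eq_abs, sq_abs, norm_sub_rev]

theorem step_descent [NeZero m] (hW : IsMixingMatrix G W) (hL : 0 < L)
    (hf : ∀ i, IsConvexSmooth L (f i)) (hg : ConvexOn ℝ univ g) (hγ : 0 ≤ γ) (hτ0 : 0 ≤ τ)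
    (hτ1 : τ ≤ 1) {st : State m d} (hst : IsTracking f st) (u : Vec d) :
    γ * (objective f g (average (step f g W K γ τ st).y) - objective f g u)
        + τ * (1 / 2 * ‖average (step f g W K γ τ st).z - average st.z‖ ^ 2
          + 1 / 2 * ‖average (step f g W K γ τ st).z - u‖ ^ 2
          + 1 / 4 * dispersion (proxStack f g W K γ τ st))
      ≤ γ * ((1 - τ) * (objective f g (average st.y) - objective f g u)
          + L / 2 * meanSqDist (step f g W K γ τ st).x (average (step f g W K γ τ st).y)
          - (1 - τ) / (2 * L) * meanSqGradDist f (average st.y) (step f g W K γ τ st).x)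
        + τ * (1 / 2 * ‖average st.z - u‖ ^ 2 + 1 / 2 * dispersion st.z
          + γ ^ 2 * dispersion (step f g W K γ τ st).s) := by
  have hst' := hst.step (g := g) (K := K) (γ := γ) (τ := τ) hW
  have hprox := average_prox_le hg hγ (z := st.z) (s := (step f g W K γ τ st).s)
    (w := proxStack f g W K γ τ st) (fun i => isProx_prox hg hγ _) u
  rw [← average_step_z hW, hst'.average_s] at hprox
  have hsmooth := expect_smooth_le hL hf hτ0 hτ1 (step f g W K γ τ st).x (average st.y)
    (average (step f g W K γ τ st).z) u
  have hconvex := hg.2 (mem_univ (average (step f g W K γ τ st).z)) (mem_univ (average st.y)) hτ0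
    (sub_nonneg.2 hτ1) (add_sub_cancel τ 1)
  rw [← average_step_y hW] at hsmooth hconvex
  simp only [smul_eq_mul] at hconvex
  simp only [objective_eq_expect]
  linarith [mul_le_mul_of_nonneg_left hprox hτ0, mul_le_mul_of_nonneg_left hsmooth hγ,
    mul_le_mul_of_nonneg_left hconvex hγ]

theorem dispersion_step_z_le {ρ : ℝ}
    (hρ : ∀ x : Stack m d, dispersion (fastMix W K x) ≤ ρ * dispersion x)
    (st : State m d) :
    dispersion (step f g W K γ τ st).z ≤ ρ * dispersion (proxStack f g W K γ τ st) :=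
  hρ _

theorem dispersion_step_y_le {ρ : ℝ}
    (hρ : ∀ x : Stack m d, dispersion (fastMix W K x) ≤ ρ * dispersion x)
    (hρ0 : 0 ≤ ρ) (hτ0 : 0 ≤ τ) (hτ1 : τ ≤ 1) (st : State m d) :
    dispersion (step f g W K γ τ st).y
      ≤ ρ * (2 * (τ ^ 2 * dispersion (step f g W K γ τ st).z) + 2 * dispersion st.y) :=
  (hρ _).trans (mul_le_mul_of_nonneg_left (dispersion_combo_le hτ0 hτ1 _ _) hρ0)

theorem dispersion_step_s_le [NeZero m] {ρ : ℝ}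
    (hρ : ∀ x : Stack m d, dispersion (fastMix W K x) ≤ ρ * dispersion x)
    (hρ0 : 0 ≤ ρ) (hL : 0 < L)
    (hf : ∀ i, IsConvexSmooth L (f i)) {st : State m d} (hst : IsTracking f st) (v : Vec d) :
    dispersion (step f g W K γ τ st).s
      ≤ ρ * (2 * dispersion st.s + 2 * (2 * meanSqGradDist f v (step f g W K γ τ st).x
        + 2 * (L ^ 2 * meanSqDist st.x v))) := by
  refine (hρ _).trans (mul_le_mul_of_nonneg_left ?_ hρ0)
  rw [hst.grad_eq, add_sub_assoc]
  refine (dispersion_add_le _ _).trans ?_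
  gcongr
  refine (dispersion_aggGradient_sub_le v _ _).trans ?_
  gcongr
  · rfl
  · exact meanSqGradDist_le hL hf v st.x

end Step

section Energy

variable {m d : ℕ} {G : SimpleGraph (Fin m)} {W : Matrix (Fin m) (Fin m) ℝ}
  {f : Fin m → Vec d → ℝ} {g : Vec d → ℝ} {K : ℕ} {L γ τ : ℝ}

/-- The Lyapunov function of the method with comparison point `u`; the weight `a` stands for
`1 / τ²`. The coefficients `103` and `5` absorb the dispersions of `z` and `y` that one iteration
leaves behind, partly through the dispersion of the next `x`. -/
def energy (f : Fin m → Vec d → ℝ) (g : Vec d → ℝ) (L : ℝ) (u : Vec d) (a : ℝ) (st : State m d) :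
    ℝ :=
  a * ((objective f g (average st.y) - objective f g u) / L) + 100 * ‖average st.z - u‖ ^ 2
    + 103 * dispersion st.z
    + a * (5 * dispersion st.y + dispersion st.s / L ^ 2 + meanSqDist st.x (average st.y))

theorem mul_suboptimality_le_energy (u : Vec d) {a : ℝ} (ha : 0 ≤ a) (st : State m d) :
    a * ((objective f g (average st.y) - objective f g u) / L) ≤ energy f g L u a st := by
  have hy := dispersion_nonneg st.y
  have hz := dispersion_nonneg st.z
  have hs := dispersion_nonneg st.s
  have hx := meanSqDist_nonneg st.x (average st.y)
  rw [energy, add_assoc, add_assoc]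
  exact le_add_of_nonneg_right (by positivity)

theorem energy_initState [NeZero m] (u x₁ : Vec d) (a : ℝ) :
    energy f g L u a (initState f x₁)
      = a * ((objective f g x₁ - objective f g u) / L) + 100 * ‖x₁ - u‖ ^ 2
        + a * (dispersion (aggGradient f fun _ => x₁) / L ^ 2) := by
  simp only [energy, initState, average_const, dispersion_const, meanSqDist_const, sub_self,
    norm_zero, ne_eq, OfNat.ofNat_ne_zero, not_false_eq_true, zero_pow, mul_zero, add_zero,
    zero_add]

theorem step_descent_normalized [NeZero m] (hW : IsMixingMatrix G W) (hL : 0 < L)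
    (hf : ∀ i, IsConvexSmooth L (f i)) (hg : ConvexOn ℝ univ g) (hτ0 : 0 < τ) (hτ1 : τ ≤ 1)
    (hγ : γ = 1 / (200 * L * τ)) {st : State m d} (hst : IsTracking f st) (u : Vec d) :
    (τ ^ 2)⁻¹ * ((objective f g (average (step f g W K γ τ st).y) - objective f g u) / L)
        + 100 * ‖average (step f g W K γ τ st).z - average st.z‖ ^ 2
        + 100 * ‖average (step f g W K γ τ st).z - u‖ ^ 2
        + 50 * dispersion (proxStack f g W K γ τ st)
      ≤ (τ ^ 2)⁻¹ * ((1 - τ) * ((objective f g (average st.y) - objective f g u) / L)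
          + 1 / 2 * meanSqDist (step f g W K γ τ st).x (average (step f g W K γ τ st).y)
          - (1 - τ) / 2 * (meanSqGradDist f (average st.y) (step f g W K γ τ st).x / L ^ 2)
          + 1 / 200 * (dispersion (step f g W K γ τ st).s / L ^ 2))
        + 100 * ‖average st.z - u‖ ^ 2 + 100 * dispersion st.z := by
  have hγ0 : 0 ≤ γ := by rw [hγ]; positivity
  have hdescent := step_descent (K := K) hW hL hf hg hγ0 hτ0.le hτ1 hst u
  rw [← mul_le_mul_iff_right₀ (show 0 < τ / 200 by positivity)]
  generalize step f g W K γ τ st = st' at hdescent ⊢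
  generalize proxStack f g W K γ τ st = w at hdescent ⊢
  subst hγ
  refine le_of_eq_of_le ?_ (hdescent.trans_eq ?_) <;> field_simp <;> ring

theorem inv_sq_mul_meanSqDist_step_x_le [NeZero m] (hW : IsMixingMatrix G W) (hτ0 : 0 < τ)
    (hτ1 : τ ≤ 1) (st : State m d) :
    (τ ^ 2)⁻¹ * meanSqDist (step f g W K γ τ st).x (average (step f g W K γ τ st).y)
      ≤ ‖average (step f g W K γ τ st).z - average st.z‖ ^ 2
        + (2 * dispersion st.z + 2 * ((τ ^ 2)⁻¹ * dispersion st.y)) := by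
  have hx : dispersion (step f g W K γ τ st).x
      ≤ 2 * (τ ^ 2 * dispersion st.z) + 2 * dispersion st.y := dispersion_combo_le hτ0.le hτ1 _ _
  rw [meanSqDist_step_x hW, inv_mul_le_iff₀ (by positivity)]
  refine (add_le_add_right hx _).trans_eq ?_
  field_simp

theorem inv_sq_mul_dispersion_step_y_le {ρ : ℝ}
    (hρ : ∀ x : Stack m d, dispersion (fastMix W K x) ≤ ρ * dispersion x) (hρ0 : 0 ≤ ρ)
    (hτ0 : 0 < τ) (hτ1 : τ ≤ 1) (st : State m d) :
    (τ ^ 2)⁻¹ * dispersion (step f g W K γ τ st).y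
      ≤ ρ * (2 * dispersion (step f g W K γ τ st).z + 2 * ((τ ^ 2)⁻¹ * dispersion st.y)) := by
  rw [inv_mul_le_iff₀ (by positivity)]
  refine (dispersion_step_y_le hρ hρ0 hτ0.le hτ1 st).trans_eq ?_
  field_simp

theorem dispersion_step_s_div_le [NeZero m] {ρ : ℝ}
    (hρ : ∀ x : Stack m d, dispersion (fastMix W K x) ≤ ρ * dispersion x) (hρ0 : 0 ≤ ρ)
    (hL : 0 < L) (hf : ∀ i, IsConvexSmooth L (f i)) {st : State m d} (hst : IsTracking f st)
    (v : Vec d) :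
    dispersion (step f g W K γ τ st).s / L ^ 2
      ≤ ρ * (2 * (dispersion st.s / L ^ 2)
        + 4 * (meanSqGradDist f v (step f g W K γ τ st).x / L ^ 2) + 4 * meanSqDist st.x v) := by
  rw [div_le_iff₀ (by positivity)]
  refine (dispersion_step_s_le hρ hρ0 hL hf hst v).trans_eq ?_
  field_simp
  ring

theorem consensus_terms_step_le (hW : IsMixingMatrix G W) (hm : 2 ≤ m) (hL : 0 < L)
    (hf : ∀ i, IsConvexSmooth L (f i)) (hτ0 : 0 < τ) (hτ1 : τ ≤ 1) {a : ℝ}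
    (ha : (τ ^ 2)⁻¹ ≤ 25 / 16 * a) {st : State m d} (hst : IsTracking f st) :
    103 * dispersion (step f g W (mixSteps W) γ τ st).z
        + (τ ^ 2)⁻¹ * (5 * dispersion (step f g W (mixSteps W) γ τ st).y
          + 201 / 200 * (dispersion (step f g W (mixSteps W) γ τ st).s / L ^ 2)
          + 3 / 2 * meanSqDist (step f g W (mixSteps W) γ τ st).x
            (average (step f g W (mixSteps W) γ τ st).y))
      ≤ 100 * ‖average (step f g W (mixSteps W) γ τ st).z - average st.z‖ ^ 2
        + 50 * dispersion (proxStack f g W (mixSteps W) γ τ st)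
        + (τ ^ 2)⁻¹ * (3 / 10 *
          (meanSqGradDist f (average st.y) (step f g W (mixSteps W) γ τ st).x / L ^ 2))
        + 3 * dispersion st.z
        + a * (5 * dispersion st.y + dispersion st.s / L ^ 2 + meanSqDist st.x (average st.y)) := by
  have : NeZero m := ⟨by lia⟩
  have hρ := hW.dispersion_fastMix_le (d := d) hm
  have hρ0 : (0 : ℝ) ≤ 1 / 10000 := by norm_num
  have hb : 0 ≤ (τ ^ 2)⁻¹ := by positivity
  have hx' := inv_sq_mul_meanSqDist_step_x_le (f := f) (g := g) (K := mixSteps W) (γ := γ) hW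
    hτ0 hτ1 st
  have hz' := dispersion_step_z_le (f := f) (g := g) (γ := γ) (τ := τ) hρ st
  have hy' := inv_sq_mul_dispersion_step_y_le (f := f) (g := g) (γ := γ) hρ hρ0 hτ0 hτ1 st
  have hs' := mul_le_mul_of_nonneg_left
    (dispersion_step_s_div_le (g := g) (γ := γ) (τ := τ) hρ hρ0 hL hf hst (average st.y)) hb
  have hgrowth : ∀ {c : ℝ}, 0 ≤ c → 0 ≤ (τ ^ 2)⁻¹ * c ∧ (τ ^ 2)⁻¹ * c ≤ 25 / 16 * (a * c) :=
    fun hc => ⟨mul_nonneg hb hc, (mul_le_mul_of_nonneg_right ha hc).trans_eq (mul_assoc _ _ _)⟩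
  have hx := hgrowth (meanSqDist_nonneg st.x (average st.y))
  have hy := hgrowth (dispersion_nonneg st.y)
  have hs := hgrowth (div_nonneg (dispersion_nonneg st.s) (sq_nonneg L))
  have hgrad := mul_nonneg hb (div_nonneg (meanSqGradDist_nonneg (f := f) (average st.y)
    (step f g W (mixSteps W) γ τ st).x) (sq_nonneg L))
  linarith [dispersion_nonneg st.z, dispersion_nonneg (proxStack f g W (mixSteps W) γ τ st),
    sq_nonneg ‖average (step f g W (mixSteps W) γ τ st).z - average st.z‖]

theorem energy_step_le (hW : IsMixingMatrix G W) (hm : 2 ≤ m) (hL : 0 < L)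
    (hf : ∀ i, IsConvexSmooth L (f i)) (hg : ConvexOn ℝ univ g) (hτ0 : 0 < τ) (hτ1 : τ ≤ 2 / 5)
    (hγ : γ = 1 / (200 * L * τ)) {a : ℝ} (ha : (τ ^ 2)⁻¹ * (1 - τ) ≤ a)
    (ha' : (τ ^ 2)⁻¹ ≤ 25 / 16 * a) {u : Vec d} (hu : ∀ v, objective f g u ≤ objective f g v)
    {st : State m d} (hst : IsTracking f st) :
    energy f g L u (τ ^ 2)⁻¹ (step f g W (mixSteps W) γ τ st) ≤ energy f g L u a st := by
  have : NeZero m := ⟨by lia⟩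
  have hτ1' : τ ≤ 1 := by linarith
  have hdescent := step_descent_normalized (K := mixSteps W) hW hL hf hg hτ0 hτ1' hγ hst u
  have hconsensus := consensus_terms_step_le (g := g) (γ := γ) hW hm hL hf hτ0 hτ1' ha' hst
  have hsubopt := mul_le_mul_of_nonneg_right ha
    (div_nonneg (sub_nonneg.2 (hu (average st.y))) hL.le)
  have hgrad : (τ ^ 2)⁻¹ * (3 / 10 * (meanSqGradDist f (average st.y)
      (step f g W (mixSteps W) γ τ st).x / L ^ 2)) ≤ (τ ^ 2)⁻¹ * ((1 - τ) / 2 *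
        (meanSqGradDist f (average st.y) (step f g W (mixSteps W) γ τ st).x / L ^ 2)) :=
    mul_le_mul_of_nonneg_left (mul_le_mul_of_nonneg_right (by linarith)
      (div_nonneg (meanSqGradDist_nonneg _ _) (sq_nonneg L))) (by positivity)
  rw [energy, energy]
  linarith

end Energy

section Rate

variable {m d : ℕ} {G : SimpleGraph (Fin m)} {W : Matrix (Fin m) (Fin m) ℝ}
  {f : Fin m → Vec d → ℝ} {g : Vec d → ℝ} {L : ℝ}

theorem weight_pos (t : ℕ) : 0 < weight t := by
  rw [weight]
  positivity

theorem stepSize_eq (L : ℝ) (t : ℕ) : stepSize L t = 1 / (200 * L * weight t) := by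
  rw [stepSize, weight]
  field_simp

theorem inv_sq_weight (t : ℕ) : (weight t ^ 2)⁻¹ = ((t : ℝ) + 4) ^ 2 / 4 := by
  rw [weight]
  field_simp
  norm_num

theorem weight_succ_le (t : ℕ) : weight (t + 1) ≤ 2 / 5 := by
  rw [weight]
  gcongr
  push_cast
  linarith [t.cast_nonneg (α := ℝ)]

theorem inv_sq_weight_succ_mul_le (t : ℕ) :
    (weight (t + 1) ^ 2)⁻¹ * (1 - weight (t + 1)) ≤ (weight t ^ 2)⁻¹ := by
  rw [inv_sq_weight, inv_sq_weight, weight]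
  push_cast
  field_simp
  linarith

theorem inv_sq_weight_succ_le (t : ℕ) :
    (weight (t + 1) ^ 2)⁻¹ ≤ 25 / 16 * (weight t ^ 2)⁻¹ := by
  rw [inv_sq_weight, inv_sq_weight]
  push_cast
  nlinarith [t.cast_nonneg (α := ℝ)]

theorem isTracking_convexRun (hW : IsMixingMatrix G W) (x₁ : Vec d) (n : ℕ) :
    IsTracking f (convexRun f g W L x₁ n) := by
  induction n with
  | zero => exact ⟨rfl, rfl⟩
  | succ n ih => exact ih.step hW

theorem gradCalls_convexRun (x₁ : Vec d) (n : ℕ) :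
    (convexRun f g W L x₁ n).gradCalls = n + 1 := by
  induction n with
  | zero => rfl
  | succ n ih => exact congrArg (· + 1) ih

theorem rounds_convexRun (x₁ : Vec d) (n : ℕ) :
    (convexRun f g W L x₁ n).rounds = 3 * mixSteps W * n := by
  induction n with
  | zero => rfl
  | succ n ih =>
    change (convexRun f g W L x₁ n).rounds + fastMixRounds _ _ _ + fastMixRounds _ _ _
      + fastMixRounds _ _ _ = _
    rw [ih, fastMixRounds_eq, fastMixRounds_eq, fastMixRounds_eq]
    ring

theorem energy_convexRun_le (hW : IsMixingMatrix G W) (hm : 2 ≤ m) (hL : 0 < L)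
    (hf : ∀ i, IsConvexSmooth L (f i)) (hg : ConvexOn ℝ univ g) {u : Vec d}
    (hu : ∀ v, objective f g u ≤ objective f g v) (x₁ : Vec d) (n : ℕ) :
    energy f g L u (weight n ^ 2)⁻¹ (convexRun f g W L x₁ n)
      ≤ energy f g L u (weight 0 ^ 2)⁻¹ (initState f x₁) := by
  induction n with
  | zero => rfl
  | succ n ih =>
    exact (energy_step_le hW hm hL hf hg (weight_pos _) (weight_succ_le n) (stepSize_eq L _)
      (inv_sq_weight_succ_mul_le n) (inv_sq_weight_succ_le n) hu
      (isTracking_convexRun hW x₁ n)).trans ih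

theorem suboptimality_convexRun_le (hW : IsMixingMatrix G W) (hm : 2 ≤ m) (hL : 0 < L)
    (hf : ∀ i, IsConvexSmooth L (f i)) (hg : ConvexOn ℝ univ g) {u : Vec d}
    (hu : ∀ v, objective f g u ≤ objective f g v) (x₁ : Vec d) (n : ℕ) :
    objective f g (average (convexRun f g W L x₁ n).y) - objective f g u
      ≤ weight n ^ 2 * (4 * (objective f g x₁ - objective f g u) + 100 * L * ‖x₁ - u‖ ^ 2
        + 4 * dispersion (aggGradient f fun _ => x₁) / L) := by
  have : NeZero m := ⟨by lia⟩
  have henergy := (mul_suboptimality_le_energy u (by positivity) _).trans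
    (energy_convexRun_le hW hm hL hf hg hu x₁ n)
  rw [energy_initState, inv_sq_weight 0, inv_mul_le_iff₀ (pow_pos (weight_pos n) 2),
    div_le_iff₀ hL] at henergy
  refine henergy.trans_eq ?_
  push_cast
  field_simp
  ring

theorem weight_sq_mul_le {E ε : ℝ} (hε : 0 < ε) {n : ℕ} (hn : 2 * √E / √ε ≤ n) :
    weight n ^ 2 * E ≤ ε := by
  have hs : 0 < √ε := Real.sqrt_pos.2 hε
  have hroot : weight n * √E ≤ √ε := by
    rw [div_le_iff₀ hs] at hn
    rw [weight, div_mul_eq_mul_div, div_le_iff₀ (by positivity)]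
    linarith
  calc weight n ^ 2 * E
      ≤ weight n ^ 2 * √E ^ 2 :=
        mul_le_mul_of_nonneg_left (Real.sqrt_le_left (Real.sqrt_nonneg E) |>.1 le_rfl) (sq_nonneg _)
    _ = (weight n * √E) ^ 2 := (mul_pow _ _ _).symm
    _ ≤ √ε ^ 2 := pow_le_pow_left₀ (mul_nonneg (weight_pos n).le (Real.sqrt_nonneg E)) hroot 2
    _ = ε := Real.sq_sqrt hε.le

theorem gradCalls_convexRun_natCeil_le {C ε : ℝ} (hC : 0 ≤ C) (hε : 0 < ε) (hε1 : ε ≤ 1)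
    (x₁ : Vec d) : ((convexRun f g W L x₁ ⌈C / √ε⌉₊).gradCalls : ℝ) ≤ (C + 2) / √ε := by
  have hs : 0 < √ε := Real.sqrt_pos.2 hε
  have hs1 : √ε ≤ 1 := Real.sqrt_le_one.2 hε1
  rw [gradCalls_convexRun, Nat.cast_add, Nat.cast_one]
  calc (⌈C / √ε⌉₊ : ℝ) + 1 ≤ (C + 1) / √ε + 1 / √ε :=
        add_le_add (natCeil_div_le hC hs hs1) ((one_le_div hs).2 hs1)
    _ = (C + 2) / √ε := by ring

theorem rounds_convexRun_natCeil_le (hW : IsMixingMatrix G W) (hm : 2 ≤ m) {C ε : ℝ} (hC : 0 ≤ C)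
    (hε : 0 < ε) (hε1 : ε ≤ 1) (x₁ : Vec d) :
    ((convexRun f g W L x₁ ⌈C / √ε⌉₊).rounds : ℝ)
      ≤ 48 * (C + 1) / √(ε * (1 - lambda2 W)) := by
  have hT : (⌈C / √ε⌉₊ : ℝ) ≤ (C + 1) / √ε :=
    natCeil_div_le hC (Real.sqrt_pos.2 hε) (Real.sqrt_le_one.2 hε1)
  rw [rounds_convexRun, Nat.cast_mul, Nat.cast_mul, Nat.cast_ofNat]
  calc (3 : ℝ) * mixSteps W * ⌈C / √ε⌉₊
      ≤ 3 * (16 / √(1 - lambda2 W)) * ((C + 1) / √ε) := by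
        gcongr
        exact hW.mixSteps_le hm
    _ = 48 * (C + 1) / √(ε * (1 - lambda2 W)) := by
        rw [Real.sqrt_mul hε.le]
        ring

end Rate

end Decentralized

end

open Decentralized in
theorem corollary2 (L : ℝ) (hL : 0 < L) (Δ D S : ℝ) :
    ∃ c₁ > 0, ∃ c₂ > 0, ∀ (m d : ℕ) (_ : 2 ≤ m)
      (G : SimpleGraph (Fin m)) (W : Matrix (Fin m) (Fin m) ℝ) (_ : IsMixingMatrix G W)
      (f : Fin m → Vec d → ℝ) (_ : ∀ i, IsConvexSmooth L (f i))
      (g : Vec d → ℝ) (_ : ConvexOn ℝ Set.univ g)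
      (xstar : Vec d) (_ : ∀ x, objective f g xstar ≤ objective f g x)
      (x₁ : Vec d) (_ : objective f g x₁ - objective f g xstar ≤ Δ) (_ : ‖x₁ - xstar‖ ≤ D)
      (_ : consensusErrorSq (aggGradient f fun _ => x₁) ≤ S)
      (ε : ℝ) (_ : 0 < ε) (_ : ε ≤ 1),
      ∃ T : ℕ,
        (∀ n ≥ T, objective f g (average (convexRun f g W L x₁ n).y) - objective f g xstar ≤ ε) ∧
        ((convexRun f g W L x₁ T).gradCalls : ℝ) ≤ c₁ / √ε ∧
        ((convexRun f g W L x₁ T).rounds : ℝ) ≤ c₂ / √(ε * (1 - lambda2 W)) := by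
  set E := 4 * Δ + 100 * L * D ^ 2 + 4 * S / L with hE
  refine ⟨2 * √E + 2, by positivity, 48 * (2 * √E + 1), by positivity, ?_⟩
  intro m d hm G W hW f hf g hg xstar hmin x₁ hΔ hD hS ε hε hε1
  refine ⟨⌈2 * √E / √ε⌉₊, fun n hn => ?_, ?_, ?_⟩
  · have hdisp := (dispersion_le_consensusErrorSq _).trans hS
    have hinit : 4 * (objective f g x₁ - objective f g xstar) + 100 * L * ‖x₁ - xstar‖ ^ 2
        + 4 * dispersion (aggGradient f fun _ => x₁) / L ≤ E := by
      rw [hE]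
      gcongr
    calc objective f g (average (convexRun f g W L x₁ n).y) - objective f g xstar
        ≤ weight n ^ 2 * E := (suboptimality_convexRun_le hW hm hL hf hg hmin x₁ n).trans
          (mul_le_mul_of_nonneg_left hinit (sq_nonneg _))
      _ ≤ ε := weight_sq_mul_le hε (Nat.ceil_le.1 hn)
  · exact gradCalls_convexRun_natCeil_le (by positivity) hε hε1 x₁
  · exact rounds_convexRun_natCeil_le hW hm (by positivity) hε hε1 x₁
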